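/- Let $\mathcal X\subset\mathbb R^d$ and $\mathcal Z\subset\mathbb R^{d'}$ be closed, and let $\mathbb H$, $\mathbb G$ be real reproducing kernel Hilbert spaces of functions on $\mathcal X$, $\mathcal Z$ with feature maps $\phi,\varphi$ (so $f(x)=\langle\phi(x),f\rangle$ for $f\in\mathbb H$, and likewise for $\varphi,\mathbb G$). Assume of each of them that it is separable; its feature map is measurable; $\|\phi\|^2$ (resp. $\|\varphi\|^2$) is integrable against every probability measure; its elements are continuous and vanish at infinity; it is dense in $L^2(\pi)$ for every probability measure $\pi$. Assume moreover that $\mathbb G$ is closed under pointwise multiplication, with $\|f\cdot g\|\le C\|f\|\|g\|$ for some constant $C$. Let $N\ge 2$. Let $Z^1,\dots,Z^N$ be random variables in $\mathcal Z$ such that the conditional law of $Z^{n+1}$ given $Z^1,\dots,Z^n$ is $u(Z^n,\cdot)$, where $u$ is a Markov kernel. Let $X^1,\dots,X^N$ be random variables in $\mathcal X$ that are conditionally independent given $(Z^1,\dots,Z^N)$, with $X^n$ having conditional law $o(Z^n,\cdot)$, where $o$ is a Markov kernel. For every $t\ge0$ let $X_t^1,\dots,X_t^N$ be related to the same $Z^1,\dots,Z^N$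 in the same way, with a Markov kernel $s_t$ in place of $o$. Let $\rho$ and $p_t$ be the laws of $(X^1,\dots,X^N)$ and $(X^1_t,\dots,X^N_t)$. Put $\mu_\rho=\mathbb E[\phi(X^1)\otimes\cdots\otimes\phi(X^N)]$ and $\mu_{p_t}=\mathbb E[\phi(X_t^1)\otimes\cdots\otimes\phi(X_t^N)]$ in the Hilbert tensor power $\mathbb H^{\otimes N}$, $\mu_{Z^{1:N}}=\mathbb E[\varphi(Z^1)\otimes\cdots\otimes\varphi(Z^N)]\in\mathbb G^{\otimes N}$ and $\mu_{Z^1}=\mathbb E[\varphi(Z^1)]\in\mathbb G$. Let $U:\mathbb G\to\mathbb G$ and $O,S_t:\mathbb G\to\mathbb H$ be bounded linear operators with $U\varphi(z)=\int\varphi(z')\,u(z,dz')$, $O\varphi(z)=\int\phi(x)\,o(z,dx)$ and $S_t\varphi(z)=\int\phi(x)\,s_t(z,dx)$ for all $z\in\mathcal Z$ and $t\ge0$. Let $U=\sum_i\lambda_i\,h_i\otimes g_i$, that is, $Uf=\sum_i\lambda_i\langle g_i,f\rangle h_i$ in norm for every $f\in\mathbb G$, with $\lambda_i\in\mathbb R$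 and $h_i,g_i\in\mathbb G$. The index set is arbitrary, and infinite sums are either unconditional sums or, for the index set $\mathbb N$, limits of partial sums (more generally, limits of finite partial sums along any fixed proper filter on the finite subsets of the index set that eventually contains each index). For $h,g\in\mathbb G$ let $[Th]g\in\mathbb G$ be the element with $\langle[Th]g,f\rangle=\langle h,f\cdot g\rangle$ for all $f\in\mathbb G$ (so $T$ is the adjoint of multiplication, and $[T\varphi(z)]g=\langle\varphi(z),g\rangle\varphi(z)$), and put $b_i=[T\mu_{Z^1}]g_i$ and $w_{i,j}=[Th_i]g_j$. Then the mean embeddings above exist as Bochner integrals, and for all $(x^1,\dots,x^N)\in\mathcal X^N$ $$\langle\phi(x^1)\otimes\cdots\otimes\phi(x^N),\mu_\rho\rangle_{\mathbb H^{\otimes N}}=\langle\phi(x^1)\otimes\cdots\otimes\phi(x^N),O^{\otimes N}\mu_{Z^{1:N}}\rangle_{\mathbb H^{\otimes N}}$$ $$=\sum_{i_2,\dots,i_N}(Ob_{i_2})(x^1)\,\lambda_{i_2}\,(Ow_{i_2,i_3})(x^2)\,\lambda_{i_3}\cdots(Ow_{i_{N-1},i_N})(x^{N-1})\,\lambda_{i_N}\,(Oh_{i_N})(x^N).$$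 Here the sum is an iterated sum over $i_2,\dots,i_N$, which converges to the stated value in whichever order the $N-1$ summations are carried out (each in the same sense as the sum for $U$). If $(h_i)$ and $(g_i)$ are orthonormal and $\sum_i\lambda_i^2<\infty$ (a singular value decomposition of a Hilbert-Schmidt operator), the family of summands is moreover unconditionally summable over all multi-indices $(i_2,\dots,i_N)$, with the same sum. For every $t\ge0$ the same holds with $\mu_{p_t}$ in place of $\mu_\rho$ and $S_t$ in place of $O$. -/

import Mathlib

open MeasureTheory ProbabilityTheory Filter Topology
open scoped NNReal ENNReal InnerProductSpace TensorProduct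

noncomputable section

namespace SpectralMeanFlow

/-! ### Hilbert tensor powers -/

universe u v

/-- A real inner product space, bundled so that tensor powers can be formed by recursion. -/
structure RealIPS where
  carrier : Type u
  [instNormed : NormedAddCommGroup carrier]
  [instInner : InnerProductSpace ℝ carrier]

attribute [instance] RealIPS.instNormed RealIPS.instInner

section TensorPower

variable (G : Type u) [NormedAddCommGroup G] [InnerProductSpace ℝ G]
variable {H : Type v} [NormedAddCommGroup H] [InnerProductSpace ℝ H]

/-- The algebraic tensor power `G ⊗ (G ⊗ ⋯)` with `n + 1` factors, with the inner product
determined by `⟪a ⊗ b, a' ⊗ b'⟫ = ⟪a, a'⟫ * ⟪b, b'⟫`. -/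
def algPow : ℕ → RealIPS.{u}
  | 0 => ⟨G⟩
  | n + 1 => ⟨G ⊗[ℝ] (algPow n).carrier⟩

/-- The Hilbert space tensor power of `G` with `n + 1` factors: the completion of the algebraic
tensor power with respect to its inner product. -/
abbrev HilbertPow (n : ℕ) : Type u := UniformSpace.Completion (algPow G n).carrier

variable {G}

/-- The elementary tensor `f 0 ⊗ ⋯ ⊗ f n` in the algebraic tensor power. -/
def algTensor : (n : ℕ) → (Fin (n + 1) → G) → (algPow G n).carrier
  | 0, f => (f 0 : G)
  | n + 1, f => (f 0 ⊗ₜ[ℝ] algTensor n (fun i => f i.succ) : G ⊗[ℝ] (algPow G n).carrier)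

/-- The elementary tensor `f 0 ⊗ ⋯ ⊗ f n` in the Hilbert tensor power. -/
def elemTensor {n : ℕ} (f : Fin (n + 1) → G) : HilbertPow G n :=
  ((algTensor n f : (algPow G n).carrier) : UniformSpace.Completion (algPow G n).carrier)

/-- `A ⊗ ⋯ ⊗ A` (`n + 1` factors) on the algebraic tensor power. -/
def algMap (A : G →L[ℝ] H) : (n : ℕ) → (algPow G n).carrier →L[ℝ] (algPow H n).carrier
  | 0 => (A : G →L[ℝ] H)
  | n + 1 => (TensorProduct.mapL A (algMap A n) :
      G ⊗[ℝ] (algPow G n).carrier →L[ℝ] H ⊗[ℝ] (algPow H n).carrier)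

/-- The tensor power `A ⊗ ⋯ ⊗ A` (`n + 1` factors) of a bounded operator, as a bounded operator
between the Hilbert tensor powers. -/
def powMap (A : G →L[ℝ] H) (n : ℕ) : HilbertPow G n →L[ℝ] HilbertPow H n :=
  (algMap A n).completion

/-- The inner product of elementary tensors is the product of the inner products. -/
theorem inner_elemTensor {n : ℕ} (f g : Fin (n + 1) → G) :
    ⟪elemTensor f, elemTensor g⟫_ℝ = ∏ i, ⟪f i, g i⟫_ℝ := by
  have key : ∀ (n : ℕ) (f g : Fin (n + 1) → G),
      ⟪algTensor n f, algTensor n g⟫_ℝ = ∏ i, ⟪f i, g i⟫_ℝ := by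
    intro n
    induction n with
    | zero =>
      intro f g
      rw [Fin.prod_univ_one]
      rfl
    | succ n ih =>
      intro f g
      rw [Fin.prod_univ_succ, ← ih]
      exact TensorProduct.inner_tmul ℝ _ _ _ _
  rw [← key]
  exact UniformSpace.Completion.inner_coe _ _

/-- `A ⊗ ⋯ ⊗ A` acts factorwise on elementary tensors. -/
theorem powMap_elemTensor (A : G →L[ℝ] H) {n : ℕ} (f : Fin (n + 1) → G) :
    powMap A n (elemTensor f) = elemTensor (fun i => A (f i)) := by
  have key : ∀ (n : ℕ) (f : Fin (n + 1) → G),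
      algMap A n (algTensor n f) = algTensor n (fun i => A (f i)) := by
    intro n
    induction n with
    | zero =>
      intro f
      rfl
    | succ n ih =>
      intro f
      have h := TensorProduct.mapL_tmul A (algMap A n) (f 0) (algTensor n fun i => f i.succ)
      rw [ih] at h
      exact h
  rw [elemTensor, elemTensor, ← key]
  exact UniformSpace.Completion.map_coe (algMap A n).uniformContinuous _

end TensorPower

/-! ### Reproducing kernel Hilbert spaces -/

section RKHSDefs

variable {S : Type*} {H : Type*} [NormedAddCommGroup H] [InnerProductSpace ℝ H] [RKHS ℝ H S ℝ]

variable (H) in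
/-- The canonical feature map of a real RKHS: `feature H x` is the element of `H` with
`⟪feature H x, f⟫ = f x` for every `f`. -/
def feature [CompleteSpace H] (x : S) : H := RKHS.kerFun H x (1 : ℝ)

/-- The reproducing property. -/
theorem inner_feature [CompleteSpace H] (x : S) (f : H) : ⟪feature H x, f⟫_ℝ = f x := by
  simp [feature]

variable (H) in
/-- The standing assumptions on a real RKHS `H` of functions on a topological and measurable
space `S`: separability, measurability of the feature map, existence of second moments,
`H ⊆ C₀(S)`, and density of `H` in `L²(π)` for every probability measure `π`. -/
structure StandingAssumptions [CompleteSpace H] [TopologicalSpace S] [MeasurableSpace S] :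
    Prop where
  separable : TopologicalSpace.SeparableSpace H
  measurable_feature : @Measurable S H _ (borel H) (feature H)
  second_moment : ∀ π : Measure S, IsProbabilityMeasure π →
    Integrable (fun x => ‖feature H x‖ ^ 2) π
  c0 : ∀ f : H, Continuous (fun x : S => f x) ∧
    Tendsto (fun x : S => f x) (cocompact S) (𝓝 0)
  l2_universal : ∀ π : Measure S, IsProbabilityMeasure π → ∀ q : S → ℝ, MemLp q 2 π →
    ∀ ε : ℝ≥0∞, ε ≠ 0 → ∃ f : H, eLpNorm (fun x => f x - q x) 2 π < ε

variable (H) in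
/-- `H` is closed under pointwise multiplication, and the multiplication is bounded. -/
def MulClosed : Prop :=
  ∃ C : ℝ, ∀ f g : H, ∃ k : H, (∀ x, k x = f x * g x) ∧ ‖k‖ ≤ C * ‖f‖ * ‖g‖

/-- The pointwise product as an element of `H`. -/
def mulFun (hH : MulClosed H) (f g : H) : H := (hH.choose_spec f g).choose

theorem mulFun_apply (hH : MulClosed H) (f g : H) (x : S) : mulFun hH f g x = f x * g x :=
  (hH.choose_spec f g).choose_spec.1 x

/-- The pointwise product as a bounded bilinear map. -/
def mulL (hH : MulClosed H) : H →L[ℝ] H →L[ℝ] H :=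
  LinearMap.mkContinuous₂
    (LinearMap.mk₂ ℝ (mulFun hH)
      (fun f f' g => RKHS.ext fun x => by simp [mulFun_apply, add_mul])
      (fun c f g => RKHS.ext fun x => by simp [mulFun_apply, mul_assoc])
      (fun f g g' => RKHS.ext fun x => by simp [mulFun_apply, mul_add])
      (fun c f g => RKHS.ext fun x => by simp [mulFun_apply, mul_left_comm]))
    hH.choose
    (fun f g => (hH.choose_spec f g).choose_spec.2)

theorem mulL_apply (hH : MulClosed H) (f g : H) (x : S) : mulL hH f g x = f x * g x :=
  mulFun_apply hH f g x

/-- The operator `T` adjoint to pointwise multiplication. The tensor `T h` is used only through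
its action `q ↦ [T h] q` as an operator on `H` (where `f ⊗ g` acts as `q ↦ ⟪g, q⟫ f`);
`comul hH h q` is `[T h] q`, so that `⟪[T h] q, f⟫ = ⟪h, f * q⟫` for all `f`. -/
def comul [CompleteSpace H] (hH : MulClosed H) (h q : H) : H :=
  ContinuousLinearMap.adjoint (mulL hH q) h

/-- The defining property of `T` as the adjoint of multiplication. -/
theorem inner_comul [CompleteSpace H] (hH : MulClosed H) (h q f : H) :
    ⟪comul hH h q, f⟫_ℝ = ⟪h, mulL hH f q⟫_ℝ := by
  rw [comul, ContinuousLinearMap.adjoint_inner_left]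
  congr 1
  exact RKHS.ext fun x => by rw [mulL_apply, mulL_apply, mul_comm]

/-- `T (feature z) = feature z ⊗ feature z`, as operators on `H`. -/
theorem comul_feature [CompleteSpace H] (hH : MulClosed H) (z : S) (q : H) :
    comul hH (feature H z) q = ⟪feature H z, q⟫_ℝ • feature H z := by
  refine ext_inner_right ℝ fun f => ?_
  rw [inner_comul, inner_feature, mulL_apply, real_inner_smul_left, inner_feature, inner_feature,
    mul_comm]

/-- If `T'` is a bounded operator from `H` to the Hilbert tensor square of `H` with
`T' (feature z) = feature z ⊗ feature z`, then `[T' h] q` (given by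
`⟪[T' h] q, f⟫ = ⟪T' h, f ⊗ q⟫`) is `comul hH h q`. -/
theorem inner_eq_inner_comul [CompleteSpace H] (hH : MulClosed H) (T' : H →L[ℝ] HilbertPow H 1)
    (hT : ∀ z : S, T' (feature H z) = elemTensor ![feature H z, feature H z]) (h q f : H) :
    ⟪T' h, elemTensor ![f, q]⟫_ℝ = ⟪comul hH h q, f⟫_ℝ := by
  rw [inner_comul]
  have hdense : Dense (Submodule.span ℝ {RKHS.kerFun H x v | (x : S) (v : ℝ)} : Set H) :=
    Submodule.dense_iff_topologicalClosure_eq_top.mpr (RKHS.kerFun_dense H)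
  have hc : (fun h => ⟪T' h, elemTensor ![f, q]⟫_ℝ) = fun h => ⟪h, mulL hH f q⟫_ℝ := by
    refine Continuous.ext_on hdense (by fun_prop) (by fun_prop) ?_
    intro k hk
    induction hk using Submodule.span_induction with
    | mem k hk =>
      obtain ⟨x, v, rfl⟩ := hk
      have hv : RKHS.kerFun H x v = v • feature H x := by
        rw [feature, ← map_smul, smul_eq_mul, mul_one]
      simp only [hv, map_smul, real_inner_smul_left, hT, inner_elemTensor,
        inner_feature, mulL_apply]
      simp [inner_feature]
    | zero => simp
    | add a b _ _ ha hb => simp only [map_add, inner_add_left] at *; rw [ha, hb]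
    | smul c a _ ha => simp only [map_smul, real_inner_smul_left] at *; rw [ha]
  exact congrFun hc h

/-- `A` is a well-specified conditional mean embedding operator for the Markov kernel `κ`:
`A (feature z) = ∫ feature y κ(z, dy)` for every `z`. -/
def WellSpecifiedCME {S' : Type*} {H' : Type*} [NormedAddCommGroup H'] [InnerProductSpace ℝ H']
    [RKHS ℝ H' S' ℝ] [CompleteSpace H] [CompleteSpace H'] [MeasurableSpace S] [MeasurableSpace S']
    (κ : Kernel S S') (A : H →L[ℝ] H') : Prop :=
  ∀ z : S, A (feature H z) = ∫ y, feature H' y ∂(κ z)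

variable (H) in
/-- The mean embedding `E[φ(Y⁰) ⊗ ⋯ ⊗ φ(Yⁿ)]` of a random sequence of length `n + 1`. -/
def seqMeanEmbedding [CompleteSpace H] {Ω : Type*} [MeasurableSpace Ω] (P : Measure Ω) {n : ℕ}
    (Y : Fin (n + 1) → Ω → S) : HilbertPow H n :=
  ∫ ω, elemTensor (fun k => feature H (Y k ω)) ∂P

end RKHSDefs

/-! ### Hidden Markov models -/

/-- `(Z, X)` is a hidden Markov model of length `N` with time-invariant transition kernel `u` and
time-invariant observation kernel `o`. The conditional law of `Z (n + 1)` given `Z 0, …, Z n` is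
`u (Z n)`; and given the whole hidden sequence, the `X n` are independent, with `X n` of
conditional law `o (Z n)`. -/
structure IsHMM {Ω 𝒵 𝒳 : Type*} [MeasurableSpace Ω] [MeasurableSpace 𝒵] [MeasurableSpace 𝒳]
    (P : Measure Ω) {N : ℕ} (Z : Fin N → Ω → 𝒵) (X : Fin N → Ω → 𝒳)
    (u : Kernel 𝒵 𝒵) (o : Kernel 𝒵 𝒳) : Prop where
  measurable_hidden : ∀ n, Measurable (Z n)
  measurable_obs : ∀ n, Measurable (X n)
  transition : ∀ (n : ℕ) (hn : n + 1 < N),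
    HasCondDistrib (Z ⟨n + 1, hn⟩)
      (fun ω (k : Fin (n + 1)) => Z ⟨k, k.isLt.trans hn⟩ ω)
      (u.comap (fun z : Fin (n + 1) → 𝒵 => z (Fin.last n)) (measurable_pi_apply _)) P
  emission : ∀ A : Set (Fin N → 𝒵), MeasurableSet A →
    ∀ B : Fin N → Set 𝒳, (∀ n, MeasurableSet (B n)) →
      P {ω | (fun n => Z n ω) ∈ A ∧ ∀ n, X n ω ∈ B n} =
        ∫⁻ ω in {ω | (fun n => Z n ω) ∈ A}, ∏ n, o (Z n ω) (B n) ∂P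

/-! ### The contraction -/

/-- `F` has iterated sum `s`, in the sense of the summation filter `L`: the sum over the last
index is the outermost one, and all the sums converge. -/
def HasIterSum {ι : Type*} (L : SummationFilter ι) :
    (m : ℕ) → ((Fin m → ι) → ℝ) → ℝ → Prop
  | 0, F, s => F ![] = s
  | m + 1, F, s => ∃ r : ι → ℝ,
      (∀ i, HasIterSum L m (fun v => F (Fin.snoc v i)) (r i)) ∧ HasSum r s L

/-- The summand `Ab_{i₂}(x¹) λ_{i₂} Aw_{i₂,i₃}(x²) λ_{i₃} ⋯ Aw_{i_{N-1},i_N}(x^{N-1}) λ_{i_N} Ah_{i_N}(x^N)`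
for sequences of length `N = m + 2`; the multi-index `(i₂, …, i_N)` is `(v 0, …, v m)`, and
`(x¹, …, x^N)` is `(x 0, …, x (m + 1))`. -/
def contractionTerm {𝒳 𝒵 H G ι : Type*} [NormedAddCommGroup H] [InnerProductSpace ℝ H]
    [RKHS ℝ H 𝒳 ℝ] [NormedAddCommGroup G] [InnerProductSpace ℝ G] [RKHS ℝ G 𝒵 ℝ] {m : ℕ}
    (A : G →L[ℝ] H) (b : ι → G) (w : ι → ι → G) (h : ι → G) (lam : ι → ℝ)
    (x : Fin (m + 2) → 𝒳) (v : Fin (m + 1) → ι) : ℝ :=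
  A (b (v 0)) (x 0)
    * (∏ k : Fin m, lam (v k.castSucc) * A (w (v k.castSucc) (v k.succ)) (x k.castSucc.succ))
    * lam (v (Fin.last m)) * A (h (v (Fin.last m))) (x (Fin.last (m + 1)))

end SpectralMeanFlow

end

open SpectralMeanFlow

/-! Put `a k = A† φ(x k)`, where `A` is `O` or `S t`. Given the hidden chain, the observations are
independent, and `∫ f d o(z) = (A† f)(z)`. So pairing the mean embedding with an elementary tensor
gives `E ∏ (A† f k)(Z k)`, which is also the pairing with `A ⊗ ⋯ ⊗ A` applied to the mean embedding
of `Z`. This is the first equality (`IsHMM.inner_seqMeanEmbedding_obs`).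

The hidden chain is then integrated out from its end: the conditional mean of `q(Z (n+1))` given the
past is `(U† q)(Z n)`, and since `G` is an algebra, `a n * U† q` is again an element of `G`. What
remains is `⟪μ, a 0 * U†(a 1 * U†(⋯ a (m+1)))⟫` with `μ` the mean embedding of `Z 0`
(`IsHMM.integral_prod_hidden`).

If the `U†` in each slot is replaced by a rank-one term `f ↦ λ ⟪h, f⟫ g`, this number becomes
exactly one summand of the contraction (`inner_chainVec_rankOne`, `contractionTerm_eq`). The strong
expansion of `U` gives a weak expansion of `U†`, which suffices for a scalar. It is valid in any one
slot with arbitrary bounded operators in the others (`hasSum_inner_chainVec`), so the slots can be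
expanded one after another in any order.

In the Hilbert-Schmidt case the summand is a chain of square-summable matrices between two `ℓ²`
vectors, so repeated Cauchy-Schwarz gives absolute summability (`summable_chain`); the total is then
identified by the iterated sum. -/

namespace SpectralMeanFlow

/-! ### Iterated sums and absolute summability of index chains. -/

section IteratedSums

variable {ι : Type*}

/-- A function of several operators which is summable in each slot is iteratedly summable. -/
theorem hasIterSum_of_forall_hasSum_update {E : Type*} (L : SummationFilter ι) (e : ι → E) (T : E)
    (n : ℕ) (V : (Fin n → E) → ℝ)
    (hV : ∀ (B : Fin n → E) (k : Fin n),
      HasSum (fun i => V (Function.update B k (e i))) (V (Function.update B k T)) L) :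
    HasIterSum L n (fun v => V (fun k => e (v k))) (V fun _ => T) := by
  induction n with
  | zero => exact congrArg V (Subsingleton.elim _ _)
  | succ n ih =>
    -- With the last index fixed at `i`, all inner slots have already been summed to `T`.
    refine ⟨fun i => V (Fin.snoc (fun _ => T) (e i)), fun i => ?_, ?_⟩
    · have key := ih (fun B => V (Fin.snoc B (e i))) fun B k => by
        simpa only [Fin.snoc_update] using hV (Fin.snoc B (e i)) k.castSucc
      convert key using 3 with v
      funext k
      refine Fin.lastCases ?_ (fun k => ?_) k <;> simp
    · have h := hV (fun _ => T) (Fin.last n)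
      have hu : ∀ y, Function.update (fun _ : Fin (n + 1) => T) (Fin.last n) y =
          Fin.snoc (fun _ => T) y := by
        intro y
        funext k
        refine Fin.lastCases ?_ (fun k => ?_) k <;> simp
      simp only [hu] at h
      convert h using 2
      funext k
      refine Fin.lastCases ?_ (fun k => ?_) k <;> simp

/-- An absolutely summable family sums to any iterated sum of it. -/
theorem HasIterSum.hasSum_of_summable (L : SummationFilter ι) [L.NeBot] [L.LeAtTop] (n : ℕ)
    (F : (Fin n → ι) → ℝ) (s : ℝ) (hF : HasIterSum L n F s) (hs : Summable F) : HasSum F s := by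
  induction n generalizing s with
  | zero =>
    have := hasSum_unique F
    rwa [show F default = s from (congrArg F (Subsingleton.elim _ _)).trans hF] at this
  | succ n ih =>
    obtain ⟨r, hr, hrs⟩ := hF
    let e := Fin.snocEquiv fun _ : Fin (n + 1) => ι
    have hs' : Summable (F ∘ e) := e.summable_iff.mpr hs
    have hslice : ∀ i, HasSum (fun v => (F ∘ e) (i, v)) (r i) := fun i =>
      ih _ _ (hr i) (hs'.prod_factor i)
    have hsum := hs'.hasSum
    have h1 : HasSum r (∑' p, (F ∘ e) p) := hsum.prod_fiberwise hslice
    -- Unconditional convergence implies convergence along `L`, where the limit is unique; this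
    -- forces the total to be `s`.
    have h2 : HasSum r (∑' p, (F ∘ e) p) L := h1.mono_left SummationFilter.LeAtTop.le_atTop
    rw [← e.hasSum_iff, hrs.unique h2]
    exact hsum

/-- Cauchy-Schwarz in each column bounds `(∑ i, |α i * K i j|) ^ 2` by `(∑ i, α i ^ 2) * ∑ i, K i j
^ 2`, which is summable over `j`. Thus one matrix of a chain can be absorbed into its left end
vector, absolute values included. -/
theorem Summable.sum_mul_sq_of_summable_sq {κ : Type*} {α : ι → ℝ} {K : ι → κ → ℝ}
    (hα : Summable fun i => α i ^ 2) (hK : Summable fun p : ι × κ => K p.1 p.2 ^ 2) :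
    (∀ j, Summable fun i => |α i * K i j|) ∧
      Summable fun j => (∑' i, |α i * K i j|) ^ 2 := by
  have hK' : Summable fun p : κ × ι => K p.2 p.1 ^ 2 := hK.prod_symm
  have hc : ∀ j, Summable fun i => K i j ^ 2 := fun j => hK'.prod_factor j
  have hα2 : Summable fun i => |α i| ^ (2 : ℝ) := by simpa using hα
  have hc2 : ∀ j, Summable fun i => |K i j| ^ (2 : ℝ) := fun j => by simpa using hc j
  have hpq : Real.HolderConjugate 2 2 := Real.HolderConjugate.two_two
  have h1 : ∀ j, Summable fun i => |α i * K i j| := fun j => by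
    simp only [abs_mul]
    exact Real.summable_mul_of_Lp_Lq_of_nonneg hpq (fun _ => abs_nonneg _) (fun _ => abs_nonneg _)
      hα2 (hc2 j)
  refine ⟨h1, ?_⟩
  refine Summable.of_nonneg_of_le (fun _ => sq_nonneg _) (fun j => ?_)
    (hK'.prod.mul_left (∑' i, α i ^ 2))
  have h2 := Real.inner_le_Lp_mul_Lq_tsum_of_nonneg hpq (fun _ => abs_nonneg _)
    (fun _ => abs_nonneg _) hα2 (hc2 j)
  have h3 : ∑' i, |α i * K i j| ≤ √(∑' i, α i ^ 2) * √(∑' i, K i j ^ 2) := by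
    simpa [abs_mul, Real.sqrt_eq_rpow] using h2
  calc (∑' i, |α i * K i j|) ^ 2 ≤ (√(∑' i, α i ^ 2) * √(∑' i, K i j ^ 2)) ^ 2 :=
        pow_le_pow_left₀ (tsum_nonneg fun _ => abs_nonneg _) h3 2
    _ = _ := by
        rw [mul_pow, Real.sq_sqrt (tsum_nonneg fun _ => sq_nonneg _),
          Real.sq_sqrt (tsum_nonneg fun _ => sq_nonneg _)]

theorem summable_prod_mul_right {κ : Type*} {A : κ → ι → ℝ} {R : κ → ℝ} (hA : ∀ v i, 0 ≤ A v i)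
    (hR : ∀ v, 0 ≤ R v) (h1 : ∀ v, Summable (A v)) (h2 : Summable fun v => (∑' i, A v i) * R v) :
    Summable fun p : κ × ι => A p.1 p.2 * R p.1 := by
  have hn : 0 ≤ fun p : κ × ι => A p.1 p.2 * R p.1 := Pi.le_def.mpr fun p =>
    mul_nonneg (hA p.1 p.2) (hR p.1)
  have hf : ∀ v, Summable fun i => A v i * R v := fun v => (h1 v).mul_right (R v)
  refine (summable_prod_of_nonneg hn).mpr ⟨hf, ?_⟩
  simpa only [tsum_mul_right] using h2

/-- A product of square-summable kernels along a chain of indices, with square-summable vectors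
at both ends, is absolutely summable. -/
theorem summable_chain (m : ℕ) (α β : ι → ℝ) (K : Fin m → ι → ι → ℝ)
    (hα : Summable fun i => α i ^ 2) (hβ : Summable fun i => β i ^ 2)
    (hK : ∀ k, Summable fun p : ι × ι => K k p.1 p.2 ^ 2) :
    Summable fun v : Fin (m + 1) → ι =>
      |α (v 0) * (∏ k : Fin m, K k (v k.castSucc) (v k.succ)) * β (v (Fin.last m))| := by
  induction m generalizing α with
  | zero =>
    rw [← (Equiv.funUnique (Fin 1) ι).symm.summable_iff]
    have h : Summable fun i => |α i| * |β i| :=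
      Real.summable_mul_of_Lp_Lq_of_nonneg Real.HolderConjugate.two_two
        (fun _ => abs_nonneg _) (fun _ => abs_nonneg _) (by simpa using hα) (by simpa using hβ)
    simpa [Function.comp_def, abs_mul] using h
  | succ m ih =>
    obtain ⟨h1, h2⟩ := Summable.sum_mul_sq_of_summable_sq hα (hK 0)
    -- Summing out the first index leaves a shorter chain with a new `ℓ²` left end.
    have h3 := ih (fun j => ∑' i, |α i * K 0 i j|) (fun k => K k.succ) h2 fun k => hK k.succ
    have h4 : Summable fun p : (Fin (m + 1) → ι) × ι => |α p.2 * K 0 p.2 (p.1 0)| *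
        |(∏ k : Fin m, K k.succ (p.1 k.castSucc) (p.1 k.succ)) * β (p.1 (Fin.last m))| := by
      refine summable_prod_mul_right (A := fun (v : Fin (m + 1) → ι) i => |α i * K 0 i (v 0)|)
        (R := fun v => |(∏ k : Fin m, K k.succ (v k.castSucc) (v k.succ)) * β (v (Fin.last m))|)
        (fun _ _ => abs_nonneg _) (fun _ => abs_nonneg _) (fun v => h1 (v 0)) (h3.congr fun v => ?_)
      rw [mul_assoc, abs_mul, abs_of_nonneg (tsum_nonneg fun _ => abs_nonneg _)]
    rw [← (Fin.consEquiv fun _ : Fin (m + 1 + 1) => ι).summable_iff,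
      ← (Equiv.prodComm _ _).summable_iff]
    refine h4.congr fun p => ?_
    simp only [Function.comp_apply, Equiv.prodComm_apply, Fin.consEquiv_apply, Prod.fst_swap,
      Prod.snd_swap, Fin.prod_univ_succ, Fin.cons_zero, Fin.castSucc_zero, Fin.cons_succ,
      ← Fin.succ_castSucc, ← Fin.succ_last]
    rw [← abs_mul]
    congr 1
    ring

end IteratedSums

/-! ### The nested element of `G` and its expansion slot by slot. -/

section Chain

variable {S G ι : Type*} [NormedAddCommGroup G] [InnerProductSpace ℝ G] [RKHS ℝ G S ℝ]

/-- The element `a 0 * B 0 (a 1 * B 1 (⋯ B (n - 1) (a n)))`. -/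
noncomputable def chainVec (hG : MulClosed G) :
    (n : ℕ) → (Fin (n + 1) → G) → (Fin n → G →L[ℝ] G) → G
  | 0, a, _ => a 0
  | n + 1, a, B => mulL hG (a 0) (B 0 (chainVec hG n (fun k => a k.succ) fun k => B k.succ))

/-- The last operator of a chain can be absorbed into the second to last vector. -/
theorem chainVec_succ_last (hG : MulClosed G) (T : G →L[ℝ] G) (n : ℕ) (a : Fin (n + 2) → G) :
    chainVec hG (n + 1) a (fun _ => T) =
      chainVec hG n (Fin.snoc (fun k : Fin n => a k.castSucc.castSucc)
        (mulL hG (a (Fin.last n).castSucc) (T (a (Fin.last (n + 1)))))) fun _ => T := by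
  induction n with
  | zero => simp [chainVec, Fin.snoc]
  | succ n ih =>
    rw [chainVec, ih, chainVec]
    congr 3
    funext k
    refine Fin.lastCases ?_ (fun k => ?_) k
    · rw [Fin.succ_last n, Fin.snoc_last, Fin.snoc_last]
      rfl
    · rw [Fin.succ_castSucc k, Fin.snoc_castSucc, Fin.snoc_castSucc]
      rfl

/-- The rank-one operator `f ↦ c * ⟪h, f⟫ • g`. -/
noncomputable def rankOne (c : ℝ) (h g : G) : G →L[ℝ] G :=
  (c • innerSL ℝ h).smulRight g

theorem rankOne_apply (c : ℝ) (h g f : G) : rankOne c h g f = (c * ⟪h, f⟫_ℝ) • g := by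
  simp [rankOne]

/-- A rank-one operator cuts the chain: `g` closes the factor on its left, and `h` becomes the test
vector `q` for the rest. Here `h` tests and `g` is the value, since the slots hold adjoints of the
terms of `U`. -/
theorem inner_chainVec_rankOne (hG : MulClosed G) (lam : ι → ℝ) (h g : ι → G) (m : ℕ)
    (a : Fin (m + 2) → G) (v : Fin (m + 1) → ι) (q : G) :
    ⟪q, chainVec hG (m + 1) a fun k => rankOne (lam (v k)) (h (v k)) (g (v k))⟫_ℝ =
      ⟪q, mulL hG (a 0) (g (v 0))⟫_ℝ *
        (∏ k : Fin m, lam (v k.castSucc) *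
          ⟪h (v k.castSucc), mulL hG (a k.castSucc.succ) (g (v k.succ))⟫_ℝ) *
        lam (v (Fin.last m)) * ⟪h (v (Fin.last m)), a (Fin.last (m + 1))⟫_ℝ := by
  induction m generalizing q with
  | zero =>
    simp only [chainVec, rankOne_apply, map_smul, real_inner_smul_right]
    simp
    ring
  | succ m ih =>
    rw [chainVec, rankOne_apply, map_smul, real_inner_smul_right,
      ih (fun k => a k.succ) (fun k => v k.succ), Fin.prod_univ_succ]
    simp only [Fin.castSucc_zero, Fin.succ_castSucc, Fin.succ_last]
    ring

variable [CompleteSpace G]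

/-- Moving everything to the left of slot `k` onto `q` by adjoints leaves `⟪q', U† c⟫ = ⟪U q', c⟫`,
and the norm expansion of `U q'` is paired with `c`. No convergence is asked of the operators in the
other slots. -/
theorem hasSum_inner_chainVec (hG : MulClosed G) (L : SummationFilter ι) (U : G →L[ℝ] G)
    (lam : ι → ℝ) (h g : ι → G)
    (hdecomp : ∀ f : G, HasSum (fun i => (lam i * ⟪g i, f⟫_ℝ) • h i) (U f) L)
    (n : ℕ) (a : Fin (n + 1) → G) (B : Fin n → G →L[ℝ] G) (k : Fin n) (q : G) :
    HasSum (fun i => ⟪q, chainVec hG n a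
        (Function.update B k (rankOne (lam i) (h i) (g i)))⟫_ℝ)
      (⟪q, chainVec hG n a (Function.update B k (ContinuousLinearMap.adjoint U))⟫_ℝ) L := by
  induction n generalizing q with
  | zero => exact k.elim0
  | succ n ih =>
    simp only [chainVec, ← ContinuousLinearMap.adjoint_inner_left (mulL hG (a 0))]
    set q' := ContinuousLinearMap.adjoint (mulL hG (a 0)) q
    cases k using Fin.cases with
    | zero =>
      have hk : ∀ T : G →L[ℝ] G, (fun k : Fin n => Function.update B 0 T k.succ) =
          fun k => B k.succ := fun T => by
        funext k
        rw [Function.update_of_ne (Fin.succ_ne_zero k)]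
      simp only [hk, Function.update_self, ContinuousLinearMap.adjoint_inner_right]
      set c := chainVec hG n (fun k => a k.succ) fun k => B k.succ
      have hs := (hdecomp q').mapL (innerSL ℝ c)
      rw [innerSL_apply_apply, real_inner_comm] at hs
      have he : ∀ i, ⟪q', rankOne (lam i) (h i) (g i) c⟫_ℝ =
          innerSL ℝ c ((lam i * ⟪g i, q'⟫_ℝ) • h i) := fun i => by
        rw [innerSL_apply_apply, rankOne_apply, real_inner_smul_right, real_inner_smul_right,
          real_inner_comm (g i), real_inner_comm (h i)]
        ring
      simpa only [he] using hs
    | succ k =>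
      have hk : ∀ T : G →L[ℝ] G, (fun j : Fin n => Function.update B k.succ T j.succ) =
          Function.update (fun j => B j.succ) k T := fun T =>
        Function.update_comp_eq_of_injective' B (Fin.succ_injective n) k T
      have h0 : ∀ T : G →L[ℝ] G, Function.update B k.succ T 0 = B 0 := fun T =>
        Function.update_of_ne (Fin.succ_ne_zero k).symm _ _
      simp only [hk, h0, ← ContinuousLinearMap.adjoint_inner_left (B 0)]
      exact ih _ _ _ _

end Chain

/-! ### Norm and continuity of elementary tensors. -/

section Tensor

variable {G : Type*} [NormedAddCommGroup G] [InnerProductSpace ℝ G]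

theorem norm_elemTensor {n : ℕ} (f : Fin (n + 1) → G) : ‖elemTensor f‖ = ∏ i, ‖f i‖ := by
  rw [← sq_eq_sq₀ (norm_nonneg _) (by positivity), ← real_inner_self_eq_norm_sq,
    inner_elemTensor, ← Finset.prod_pow]
  simp only [real_inner_self_eq_norm_sq]

theorem continuous_algTensor (n : ℕ) :
    Continuous fun f : Fin (n + 1) → G => algTensor n f := by
  induction n with
  | zero => exact continuous_apply 0
  | succ n ih =>
    have h1 : Continuous fun f : Fin (n + 2) → G =>
        (f 0, algTensor n fun i => f i.succ) :=
      (continuous_apply 0).prodMk (ih.comp (continuous_pi fun i => continuous_apply i.succ))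
    exact (TensorProduct.continuous_tmul (𝕜 := ℝ) (E := G) (F := (algPow G n).carrier)).comp h1

theorem continuous_elemTensor (n : ℕ) :
    Continuous (elemTensor : (Fin (n + 1) → G) → HilbertPow G n) :=
  (UniformSpace.Completion.continuous_coe _).comp (continuous_algTensor n)

end Tensor

/-! ### Bounded features and pairings with mean embeddings. -/

section Feature

variable {S H : Type*} [NormedAddCommGroup H] [InnerProductSpace ℝ H] [RKHS ℝ H S ℝ]
  [CompleteSpace H] [TopologicalSpace S] [MeasurableSpace S]

/-- Functions vanishing at infinity are bounded, so the evaluation functionals are pointwise bounded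
on `H`, and Banach-Steinhaus makes them uniformly bounded. All Bochner integrals exist for this
reason. -/
theorem StandingAssumptions.exists_norm_feature_le (hH : StandingAssumptions H) :
    ∃ C, ∀ x : S, ‖feature H x‖ ≤ C := by
  have hb : ∀ f : H, ∃ C, ∀ x : S, ‖innerSL ℝ (feature H x) f‖ ≤ C := fun f => by
    let F : ZeroAtInftyContinuousMap S ℝ := ⟨⟨fun x => f x, (hH.c0 f).1⟩, (hH.c0 f).2⟩
    obtain ⟨C, hC⟩ := (ZeroAtInftyContinuousMap.isBounded_range F).exists_norm_le
    exact ⟨C, fun x => by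
      simpa [inner_feature, F] using hC _ (Set.mem_range_self x)⟩
  obtain ⟨C, hC⟩ := banach_steinhaus hb
  exact ⟨C, fun x => by simpa using hC x⟩

theorem StandingAssumptions.stronglyMeasurable_feature (hH : StandingAssumptions H) :
    StronglyMeasurable (feature H : S → H) := by
  borelize H
  have := hH.separable
  have := UniformSpace.secondCountable_of_separable H
  exact hH.measurable_feature.stronglyMeasurable

theorem StandingAssumptions.integrable_feature (hH : StandingAssumptions H) (μ : Measure S)
    [IsFiniteMeasure μ] : Integrable (feature H : S → H) μ := by
  obtain ⟨C, hC⟩ := hH.exists_norm_feature_le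
  exact .of_bound hH.stronglyMeasurable_feature.aestronglyMeasurable C (.of_forall hC)

theorem StandingAssumptions.measurable_coe (hH : StandingAssumptions H) (f : H) :
    Measurable fun x : S => f x := by
  simp only [← inner_feature]
  exact (hH.stronglyMeasurable_feature.inner stronglyMeasurable_const).measurable

theorem StandingAssumptions.exists_abs_le (hH : StandingAssumptions H) (f : H) :
    ∃ C, ∀ x : S, |f x| ≤ C := by
  obtain ⟨C, hC⟩ := hH.exists_norm_feature_le
  refine ⟨C * ‖f‖, fun x => ?_⟩
  rw [← inner_feature]
  exact (abs_real_inner_le_norm _ _).trans (by gcongr; exact hC x)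

theorem StandingAssumptions.integrable_elemTensor (hH : StandingAssumptions H) {Ω : Type*}
    [MeasurableSpace Ω] (P : Measure Ω) [IsFiniteMeasure P] {n : ℕ} {Y : Fin (n + 1) → Ω → S}
    (hY : ∀ k, Measurable (Y k)) :
    Integrable (fun ω => elemTensor fun k => feature H (Y k ω)) P := by
  obtain ⟨C, hC⟩ := hH.exists_norm_feature_le
  have hm : StronglyMeasurable fun ω => fun k => feature H (Y k ω) := by
    borelize H
    have := hH.separable
    have := UniformSpace.secondCountable_of_separable H
    exact (measurable_pi_lambda _ fun k => hH.measurable_feature.comp (hY k)).stronglyMeasurable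
  refine .of_bound ((continuous_elemTensor n).comp_stronglyMeasurable hm).aestronglyMeasurable
    (∏ _k : Fin (n + 1), C) (.of_forall fun ω => ?_)
  rw [norm_elemTensor]
  exact Finset.prod_le_prod (fun _ _ => norm_nonneg _) fun k _ => hC _

theorem StandingAssumptions.inner_seqMeanEmbedding (hH : StandingAssumptions H) {Ω : Type*}
    [MeasurableSpace Ω] (P : Measure Ω) [IsFiniteMeasure P] {n : ℕ} {Y : Fin (n + 1) → Ω → S}
    (hY : ∀ k, Measurable (Y k)) (f : Fin (n + 1) → H) :
    ⟪elemTensor f, seqMeanEmbedding H P Y⟫_ℝ = ∫ ω, ∏ k, f k (Y k ω) ∂P := by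
  rw [seqMeanEmbedding, ← integral_inner (hH.integrable_elemTensor P hY)]
  simp only [inner_elemTensor, real_inner_comm _ (f _), inner_feature]

theorem StandingAssumptions.inner_powMap_seqMeanEmbedding (hH : StandingAssumptions H)
    {H' : Type*} [NormedAddCommGroup H'] [InnerProductSpace ℝ H'] [CompleteSpace H'] {Ω : Type*}
    [MeasurableSpace Ω] (P : Measure Ω) [IsFiniteMeasure P] {n : ℕ} {Y : Fin (n + 1) → Ω → S}
    (hY : ∀ k, Measurable (Y k)) (A : H →L[ℝ] H') (f : Fin (n + 1) → H') :
    ⟪elemTensor f, powMap A n (seqMeanEmbedding H P Y)⟫_ℝ =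
      ∫ ω, ∏ k, (ContinuousLinearMap.adjoint A (f k)) (Y k ω) ∂P := by
  have hi := hH.integrable_elemTensor P hY
  rw [seqMeanEmbedding, ← ContinuousLinearMap.integral_comp_comm _ hi,
    ← integral_inner ((powMap A n).integrable_comp hi)]
  simp only [powMap_elemTensor, inner_elemTensor, ← ContinuousLinearMap.adjoint_inner_left A,
    real_inner_comm _ (ContinuousLinearMap.adjoint A (f _)), inner_feature]

end Feature

/-! ### Adjoints of conditional mean embeddings act as kernels on functions. -/

section ConditionalMeanEmbedding

variable {S H S' H' : Type*} [NormedAddCommGroup H] [InnerProductSpace ℝ H] [RKHS ℝ H S ℝ]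
  [CompleteSpace H] [MeasurableSpace S] [NormedAddCommGroup H'] [InnerProductSpace ℝ H']
  [RKHS ℝ H' S' ℝ] [CompleteSpace H'] [TopologicalSpace S'] [MeasurableSpace S']

/-- The conditional mean embedding property, tested against an element of the target space. -/
theorem WellSpecifiedCME.adjoint_apply {κ : Kernel S S'} [IsFiniteKernel κ] {A : H →L[ℝ] H'}
    (hA : WellSpecifiedCME κ A) (hH' : StandingAssumptions H') (f : H') (z : S) :
    (ContinuousLinearMap.adjoint A f) z = ∫ y, f y ∂(κ z) := by
  rw [← inner_feature, ContinuousLinearMap.adjoint_inner_right, hA, real_inner_comm,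
    ← integral_inner (hH'.integrable_feature _)]
  simp only [real_inner_comm _ f, inner_feature]

end ConditionalMeanEmbedding

/-! ### Integrating out the observations. -/

section HiddenMarkov

variable {Ω 𝒵 𝒳 : Type*} [MeasurableSpace Ω] [MeasurableSpace 𝒵] [MeasurableSpace 𝒳]
  {P : Measure Ω} [IsProbabilityMeasure P] {N : ℕ} {Z : Fin N → Ω → 𝒵} {X : Fin N → Ω → 𝒳}
  {u : Kernel 𝒵 𝒵} {o : Kernel 𝒵 𝒳} [IsMarkovKernel o]

variable (o) in
theorem measurable_pi_kernel (hZ : ∀ n, Measurable (Z n)) :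
    Measurable fun ω => Measure.pi fun n => o (Z n ω) := by
  refine .measure_of_isPiSystem_of_isProbabilityMeasure generateFrom_pi.symm isPiSystem_pi ?_
  rintro _ ⟨B, hB, rfl⟩
  simp only [Measure.pi_pi]
  exact Finset.measurable_prod _ fun n _ =>
    (o.measurable_coe (hB n (Set.mem_univ n))).comp (hZ n)

/-- The law of the observations is the mixture of the product measures of the emission laws. -/
theorem IsHMM.map_obs (hX : IsHMM P Z X u o) :
    P.map (fun ω n => X n ω) =
      P.bind (⟨fun ω => Measure.pi fun n => o (Z n ω),
        measurable_pi_kernel o hX.measurable_hidden⟩ : Kernel Ω (Fin N → 𝒳)) := by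
  have hm : Measurable fun ω n => X n ω := measurable_pi_lambda _ hX.measurable_obs
  have : IsProbabilityMeasure (P.map fun ω n => X n ω) :=
    Measure.isProbabilityMeasure_map hm.aemeasurable
  refine ext_of_generate_finite _ generateFrom_pi.symm isPiSystem_pi ?_ ?_
  · rintro _ ⟨B, hB, rfl⟩
    have hB' : ∀ n, MeasurableSet (B n) := fun n => hB n (Set.mem_univ n)
    have hBm : MeasurableSet (Set.univ.pi B) := .univ_pi hB'
    -- With no restriction on the hidden sequence, the emission identity gives the law on
    -- rectangles, which determine it.
    have h := hX.emission Set.univ .univ B hB'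
    simp only [Set.mem_univ, true_and, Set.ofPred_true, Measure.restrict_univ] at h
    rw [Measure.map_apply hm hBm, Measure.bind_apply hBm (Kernel.aemeasurable _)]
    simp only [Kernel.coe_mk, Measure.pi_pi, ← h]
    congr 1
    ext ω
    simp
  · rw [Measure.map_apply hm .univ, Measure.bind_apply .univ (Kernel.aemeasurable _)]
    simp

theorem IsHMM.integral_prod_obs (hX : IsHMM P Z X u o) (f : Fin N → 𝒳 → ℝ)
    (hf : ∀ n, Measurable (f n)) (hfb : ∀ n, ∃ C, ∀ x, |f n x| ≤ C) :
    ∫ ω, ∏ n, f n (X n ω) ∂P = ∫ ω, ∏ n, ∫ x, f n x ∂(o (Z n ω)) ∂P := by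
  have hm : Measurable fun ω n => X n ω := measurable_pi_lambda _ hX.measurable_obs
  have hF : Measurable fun x : Fin N → 𝒳 => ∏ n, f n (x n) :=
    Finset.measurable_prod _ fun n _ => (hf n).comp (measurable_pi_apply n)
  choose C hC using hfb
  have : IsProbabilityMeasure (P.map fun ω n => X n ω) :=
    Measure.isProbabilityMeasure_map hm.aemeasurable
  have hi : Integrable (fun x : Fin N → 𝒳 => ∏ n, f n (x n)) (P.map fun ω n => X n ω) := by
    refine .of_bound hF.aestronglyMeasurable (∏ n, C n) (.of_forall fun x => ?_)
    rw [Real.norm_eq_abs, Finset.abs_prod]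
    exact Finset.prod_le_prod (fun _ _ => abs_nonneg _) fun n _ => hC n _
  rw [← integral_map hm.aemeasurable (f := fun x : Fin N → 𝒳 => ∏ n, f n (x n))
    hF.aestronglyMeasurable]
  rw [hX.map_obs] at hi ⊢
  -- The mixture is read as a composition with a constant kernel, to which Fubini for kernels
  -- applies.
  rw [Measure.comp_eq_comp_const_apply] at hi ⊢
  rw [Kernel.integral_comp hi]
  simp only [Kernel.coe_mk, Kernel.const_apply, integral_fintype_prod_eq_prod]

end HiddenMarkov

/-! ### Integrating out the hidden chain. -/

section MarkovChain

variable {Ω 𝒵 𝒳 G : Type*} [MeasurableSpace Ω] [TopologicalSpace 𝒵] [MeasurableSpace 𝒵]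
  [MeasurableSpace 𝒳] [NormedAddCommGroup G] [InnerProductSpace ℝ G] [RKHS ℝ G 𝒵 ℝ]
  [CompleteSpace G] {P : Measure Ω} [IsProbabilityMeasure P] {N : ℕ} {Z : Fin N → Ω → 𝒵}
  {X : Fin N → Ω → 𝒳} {u : Kernel 𝒵 𝒵} [IsMarkovKernel u] {o : Kernel 𝒵 𝒳}

/-- One step of the Markov chain. -/
theorem IsHMM.integral_prod_succ (hX : IsHMM P Z X u o) (hG : StandingAssumptions G)
    {U : G →L[ℝ] G} (hU : WellSpecifiedCME u U) (n : ℕ) (hn : n + 1 < N)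
    (f : Fin (n + 1) → G) (q : G) :
    ∫ ω, (∏ k : Fin (n + 1), f k (Z ⟨k, k.isLt.trans hn⟩ ω)) * q (Z ⟨n + 1, hn⟩ ω) ∂P =
      ∫ ω, (∏ k : Fin (n + 1), f k (Z ⟨k, k.isLt.trans hn⟩ ω)) *
        (ContinuousLinearMap.adjoint U q) (Z ⟨n, n.lt_succ_self.trans hn⟩ ω) ∂P := by
  have hlaw := hX.transition n hn
  set past : Ω → Fin (n + 1) → 𝒵 := fun ω k => Z ⟨k, k.isLt.trans hn⟩ ω
  have hpm : Measurable past := measurable_pi_lambda _ fun k => hX.measurable_hidden _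
  have : IsProbabilityMeasure (P.map past) := Measure.isProbabilityMeasure_map hpm.aemeasurable
  let F : (Fin (n + 1) → 𝒵) × 𝒵 → ℝ := fun p => (∏ k, f k (p.1 k)) * q p.2
  have hF : Measurable F :=
    (Finset.measurable_prod _ fun k _ => (hG.measurable_coe (f k)).comp
      ((measurable_pi_apply k).comp measurable_fst)).mul ((hG.measurable_coe q).comp measurable_snd)
  have hi : Integrable F ((P.map past) ⊗ₘ
      (u.comap (fun z : Fin (n + 1) → 𝒵 => z (Fin.last n)) (measurable_pi_apply _))) := by
    choose C hC using fun k => hG.exists_abs_le (f k)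
    obtain ⟨D, hD⟩ := hG.exists_abs_le q
    refine .of_bound hF.aestronglyMeasurable ((∏ k, C k) * D) (.of_forall fun p => ?_)
    rw [Real.norm_eq_abs, abs_mul, Finset.abs_prod]
    have h1 : ∏ k, |f k (p.1 k)| ≤ ∏ k, C k :=
      Finset.prod_le_prod (fun _ _ => abs_nonneg _) fun k _ => hC k _
    exact mul_le_mul h1 (hD _) (abs_nonneg _)
      (h1.trans' (Finset.prod_nonneg fun _ _ => abs_nonneg _))
  have h1 := integral_map hlaw.aemeasurable (f := F) hF.aestronglyMeasurable
  rw [hlaw.map_eq, Measure.integral_compProd hi] at h1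
  refine h1.symm.trans ?_
  simp only [F, integral_const_mul, Kernel.comap_apply, ← hU.adjoint_apply hG]
  rw [integral_map hpm.aemeasurable]
  · rfl
  · exact ((Finset.measurable_prod _ fun k _ => (hG.measurable_coe (f k)).comp
      (measurable_pi_apply k)).mul
      ((hG.measurable_coe _).comp (measurable_pi_apply _))).aestronglyMeasurable

/-- Induction on the prefix of the chain: integrating out the last variable leaves `U†` of the last
function at the preceding state, where multiplicative closure merges it with the function already
there. `chainVec_succ_last` is the same move on the nested element. -/
theorem IsHMM.integral_prod_hidden (hX : IsHMM P Z X u o) (hG : StandingAssumptions G)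
    (hGmul : MulClosed G) {U : G →L[ℝ] G} (hU : WellSpecifiedCME u U) (n : ℕ) (hn : n < N)
    (f : Fin (n + 1) → G) :
    ∫ ω, ∏ k : Fin (n + 1), f k (Z ⟨k, k.isLt.trans_le hn⟩ ω) ∂P =
      ⟪∫ ω, feature G (Z ⟨0, n.zero_le.trans_lt hn⟩ ω) ∂P,
        chainVec hGmul n f fun _ => ContinuousLinearMap.adjoint U⟫_ℝ := by
  induction n with
  | zero =>
    have hi : Integrable (fun ω => feature G (Z ⟨0, hn⟩ ω)) P :=
      (hG.integrable_feature (P.map (Z ⟨0, hn⟩))).comp_measurable (hX.measurable_hidden _)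
    rw [real_inner_comm, ← integral_inner hi]
    simp only [chainVec, real_inner_comm _ (f 0), inner_feature]
    exact integral_congr_ae (.of_forall fun ω => Fin.prod_univ_one _)
  | succ n ih =>
    rw [chainVec_succ_last, ← ih (n.lt_succ_self.trans hn)]
    simp only [Fin.prod_univ_castSucc (n := n + 1)]
    refine (hX.integral_prod_succ hG hU n hn (fun k => f k.castSucc)
      (f (Fin.last (n + 1)))).trans ?_
    simp only [Fin.prod_univ_castSucc (n := n), Fin.snoc_castSucc, Fin.snoc_last, mulL_apply,
      mul_assoc]
    rfl

end MarkovChain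

theorem summable_inner_sq_of_orthonormal {ι E : Type*} [NormedAddCommGroup E]
    [InnerProductSpace ℝ E] {e : ι → E} (he : Orthonormal ℝ e) (q : E) :
    Summable fun i => ⟪q, e i⟫_ℝ ^ 2 := by
  simpa [real_inner_comm] using he.inner_products_summable (x := q)

/-! ### The contraction formula. -/

section Contraction

variable {𝒵 𝒳 G H ι : Type*} [NormedAddCommGroup G] [InnerProductSpace ℝ G] [RKHS ℝ G 𝒵 ℝ]
  [CompleteSpace G] [NormedAddCommGroup H] [InnerProductSpace ℝ H] [RKHS ℝ H 𝒳 ℝ]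
  [CompleteSpace H]

theorem apply_eq_inner_adjoint (A : G →L[ℝ] H) (f : G) (x : 𝒳) :
    A f x = ⟪f, ContinuousLinearMap.adjoint A (feature H x)⟫_ℝ := by
  rw [ContinuousLinearMap.adjoint_inner_right, real_inner_comm, inner_feature]

theorem contractionTerm_eq (hG : MulClosed G) (A : G →L[ℝ] H) (q : G) (h g : ι → G) (lam : ι → ℝ)
    {m : ℕ} (x : Fin (m + 2) → 𝒳) (v : Fin (m + 1) → ι) :
    contractionTerm A (fun i => comul hG q (g i)) (fun i j => comul hG (h i) (g j)) h lam x v =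
      ⟪q, mulL hG (ContinuousLinearMap.adjoint A (feature H (x 0))) (g (v 0))⟫_ℝ *
        (∏ k : Fin m, lam (v k.castSucc) * ⟪h (v k.castSucc),
          mulL hG (ContinuousLinearMap.adjoint A (feature H (x k.castSucc.succ)))
            (g (v k.succ))⟫_ℝ) *
        lam (v (Fin.last m)) *
        ⟪h (v (Fin.last m)), ContinuousLinearMap.adjoint A (feature H (x (Fin.last (m + 1))))⟫_ℝ := by
  simp only [contractionTerm, apply_eq_inner_adjoint, inner_comul]

/-- The matrix of a Hilbert-Schmidt operator with singular values `lam`, composed with a bounded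
operator, is square-summable. -/
theorem summable_sq_hilbertSchmidt {h g : ι → G} {lam : ι → ℝ} (hh : Orthonormal ℝ h)
    (hg : Orthonormal ℝ g) (hlam : Summable fun i => lam i ^ 2) (T : G →L[ℝ] G) :
    Summable fun p : ι × ι => (lam p.1 * ⟪h p.1, T (g p.2)⟫_ℝ) ^ 2 := by
  simp only [← ContinuousLinearMap.adjoint_inner_left T]
  set T' := ContinuousLinearMap.adjoint T
  have hs : ∀ i, Summable fun j => (lam i * ⟪T' (h i), g j⟫_ℝ) ^ 2 := fun i => by
    simpa only [mul_pow] using (summable_inner_sq_of_orthonormal hg (T' (h i))).mul_left (lam i ^ 2)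
  have hn : 0 ≤ fun p : ι × ι => (lam p.1 * ⟪T' (h p.1), g p.2⟫_ℝ) ^ 2 :=
    Pi.le_def.mpr fun p => sq_nonneg _
  refine (summable_prod_of_nonneg hn).mpr ⟨hs, ?_⟩
  -- By Bessel for `g`, row `i` sums to at most `lam i ^ 2 * ‖T' (h i)‖ ^ 2`, and `h i` is a unit
  -- vector.
  refine .of_nonneg_of_le (fun i => tsum_nonneg fun j => sq_nonneg _) (fun i => ?_)
    (hlam.mul_right (‖T'‖ ^ 2))
  simp only [mul_pow, tsum_mul_left]
  gcongr
  have hb : ∑' j, ⟪T' (h i), g j⟫_ℝ ^ 2 ≤ ‖T' (h i)‖ ^ 2 := by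
    simpa [real_inner_comm] using hg.tsum_inner_products_le (x := T' (h i))
  refine hb.trans ?_
  gcongr
  simpa [hh.1 i] using T'.le_opNorm (h i)

/-- Each `lam` is grouped with the factor to its right. The left end is then in `ℓ²` by Bessel, the
right end because `lam` is, and the matrices between are Hilbert-Schmidt. -/
theorem summable_contractionTerm (hG : MulClosed G) (A : G →L[ℝ] H) (q : G) {h g : ι → G}
    {lam : ι → ℝ} (hh : Orthonormal ℝ h) (hg : Orthonormal ℝ g)
    (hlam : Summable fun i => lam i ^ 2) {m : ℕ} (x : Fin (m + 2) → 𝒳) :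
    Summable (contractionTerm A (fun i => comul hG q (g i))
      (fun i j => comul hG (h i) (g j)) h lam x) := by
  set a := fun k => ContinuousLinearMap.adjoint A (feature H (x k))
  refine Summable.of_abs ((summable_chain m (fun i => ⟪q, mulL hG (a 0) (g i)⟫_ℝ)
    (fun i => lam i * ⟪h i, a (Fin.last (m + 1))⟫_ℝ)
    (fun k i j => lam i * ⟪h i, mulL hG (a k.castSucc.succ) (g j)⟫_ℝ) ?_ ?_ fun k =>
      summable_sq_hilbertSchmidt hh hg hlam _).congr fun v => ?_)
  · simp only [← ContinuousLinearMap.adjoint_inner_left (mulL hG (a 0))]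
    exact summable_inner_sq_of_orthonormal hg _
  · refine .of_nonneg_of_le (fun i => sq_nonneg _) (fun i => ?_)
      (hlam.mul_right (‖a (Fin.last (m + 1))‖ ^ 2))
    rw [mul_pow]
    refine mul_le_mul_of_nonneg_left (sq_le_sq.mpr ?_) (sq_nonneg _)
    rw [abs_norm]
    simpa [hh.1 i] using abs_real_inner_le_norm (h i) (a (Fin.last (m + 1)))
  · rw [contractionTerm_eq, mul_assoc _ (lam _)]

theorem hasIterSum_contractionTerm (hG : MulClosed G) (A : G →L[ℝ] H) (q : G)
    (L : SummationFilter ι) (U : G →L[ℝ] G) (lam : ι → ℝ) (h g : ι → G)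
    (hdecomp : ∀ f : G, HasSum (fun i => (lam i * ⟪g i, f⟫_ℝ) • h i) (U f) L)
    {m : ℕ} (x : Fin (m + 2) → 𝒳) (σ : Equiv.Perm (Fin (m + 1))) :
    HasIterSum L (m + 1) (fun v => contractionTerm A (fun i => comul hG q (g i))
        (fun i j => comul hG (h i) (g j)) h lam x (v ∘ σ))
      ⟪q, chainVec hG (m + 1) (fun k => ContinuousLinearMap.adjoint A (feature H (x k)))
        fun _ => ContinuousLinearMap.adjoint U⟫_ℝ := by
  simp only [contractionTerm_eq]
  simp only [← inner_chainVec_rankOne hG lam h g m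
    (fun k => ContinuousLinearMap.adjoint A (feature H (x k)))]
  refine hasIterSum_of_forall_hasSum_update L (fun i => rankOne (lam i) (h i) (g i))
    (ContinuousLinearMap.adjoint U) (m + 1)
    (fun B => ⟪q, chainVec hG (m + 1)
      (fun k => ContinuousLinearMap.adjoint A (feature H (x k))) (B ∘ σ)⟫_ℝ) fun B k => ?_
  -- Permuting the indices permutes the slots: expanding slot `k` of `B` expands slot `σ⁻¹ k` of the
  -- chain.
  simp only [Function.update_comp_equiv]
  exact hasSum_inner_chainVec hG L U lam h g hdecomp _ _ _ _ q

variable [TopologicalSpace 𝒵] [MeasurableSpace 𝒵] [TopologicalSpace 𝒳] [MeasurableSpace 𝒳]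
  {Ω : Type*} [MeasurableSpace Ω] {P : Measure Ω} [IsProbabilityMeasure P]
  {u : Kernel 𝒵 𝒵} {o : Kernel 𝒵 𝒳} [IsMarkovKernel o]

theorem IsHMM.inner_seqMeanEmbedding_obs (hH : StandingAssumptions H) (hG : StandingAssumptions G)
    {n : ℕ} {Z : Fin (n + 1) → Ω → 𝒵} {X : Fin (n + 1) → Ω → 𝒳} (hX : IsHMM P Z X u o)
    {A : G →L[ℝ] H} (hA : WellSpecifiedCME o A) (f : Fin (n + 1) → H) :
    ⟪elemTensor f, seqMeanEmbedding H P X⟫_ℝ =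
      ⟪elemTensor f, powMap A n (seqMeanEmbedding G P Z)⟫_ℝ := by
  rw [hH.inner_seqMeanEmbedding P hX.measurable_obs,
    hG.inner_powMap_seqMeanEmbedding P hX.measurable_hidden,
    hX.integral_prod_obs (fun k y => f k y) (fun k => hH.measurable_coe _)
      (fun k => hH.exists_abs_le _)]
  simp only [hA.adjoint_apply hH]

/-- The emission kernel and its operator `A` are generic, so that the case of `o`, `O` and that of
`s t`, `S t` are both instances. -/
theorem IsHMM.meanEmbedding_contraction [IsMarkovKernel u]
    (hH : StandingAssumptions H) (hG : StandingAssumptions G)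
    (hGmul : MulClosed G) {m : ℕ} {Z : Fin (m + 2) → Ω → 𝒵} {X : Fin (m + 2) → Ω → 𝒳}
    (hX : IsHMM P Z X u o) {U : G →L[ℝ] G} (hU : WellSpecifiedCME u U)
    {A : G →L[ℝ] H} (hA : WellSpecifiedCME o A)
    (L : SummationFilter ι) [L.NeBot] [L.LeAtTop] (lam : ι → ℝ) (h g : ι → G)
    (hdecomp : ∀ f : G, HasSum (fun i => (lam i * ⟪g i, f⟫_ℝ) • h i) (U f) L)
    (b : ι → G) (hb : ∀ i, b i = comul hGmul (∫ ω, feature G (Z 0 ω) ∂P) (g i))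
    (w : ι → ι → G) (hw : ∀ i j, w i j = comul hGmul (h i) (g j)) (x : Fin (m + 2) → 𝒳) :
    Integrable (fun ω => elemTensor fun k => feature H (X k ω)) P ∧
      ⟪elemTensor fun k => feature H (x k), seqMeanEmbedding H P X⟫_ℝ =
        ⟪elemTensor fun k => feature H (x k), powMap A (m + 1) (seqMeanEmbedding G P Z)⟫_ℝ ∧
      (∀ σ : Equiv.Perm (Fin (m + 1)),
        HasIterSum L (m + 1) (fun v => contractionTerm A b w h lam x (v ∘ σ))
          ⟪elemTensor fun k => feature H (x k), seqMeanEmbedding H P X⟫_ℝ) ∧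
      (Orthonormal ℝ h → Orthonormal ℝ g → Summable (fun i => lam i ^ 2) →
        HasSum (contractionTerm A b w h lam x)
          ⟪elemTensor fun k => feature H (x k), seqMeanEmbedding H P X⟫_ℝ) := by
  obtain rfl : b = fun i => comul hGmul (∫ ω, feature G (Z 0 ω) ∂P) (g i) := funext hb
  obtain rfl : w = fun i j => comul hGmul (h i) (g j) := funext₂ hw
  have heq := hX.inner_seqMeanEmbedding_obs hH hG hA fun k => feature H (x k)
  have hiter : ∀ σ : Equiv.Perm (Fin (m + 1)), HasIterSum L (m + 1) _
      ⟪elemTensor fun k => feature H (x k), seqMeanEmbedding H P X⟫_ℝ := fun σ => by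
    rw [heq, hG.inner_powMap_seqMeanEmbedding P hX.measurable_hidden]
    refine Eq.subst (motive := HasIterSum L (m + 1) _)
      (hX.integral_prod_hidden hG hGmul hU (m + 1) (Nat.lt_succ_self _) _).symm ?_
    exact hasIterSum_contractionTerm hGmul A (∫ ω, feature G (Z 0 ω) ∂P) L U lam h g hdecomp x σ
  refine ⟨hH.integrable_elemTensor P hX.measurable_obs, heq, hiter, fun hh hg hlam => ?_⟩
  -- One order of summation suffices to identify an absolutely convergent sum.
  exact HasIterSum.hasSum_of_summable L _ _ _ (hiter (Equiv.refl _))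
    (summable_contractionTerm hGmul A _ hh hg hlam x)

end Contraction

end SpectralMeanFlow

theorem mainTheorem3
    {d d' : ℕ} {𝒳 : Set (EuclideanSpace ℝ (Fin d))} (h𝒳 : IsClosed 𝒳)
    {𝒵 : Set (EuclideanSpace ℝ (Fin d'))} (h𝒵 : IsClosed 𝒵)
    {H : Type*} [NormedAddCommGroup H] [InnerProductSpace ℝ H] [CompleteSpace H] [RKHS ℝ H 𝒳 ℝ]
    {G : Type*} [NormedAddCommGroup G] [InnerProductSpace ℝ G] [CompleteSpace G] [RKHS ℝ G 𝒵 ℝ]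
    (hH : StandingAssumptions H) (hG : StandingAssumptions G) (hGmul : MulClosed G)
    {Ω : Type*} [MeasurableSpace Ω] (P : Measure Ω) [IsProbabilityMeasure P] {m : ℕ}
    (u : Kernel 𝒵 𝒵) [IsMarkovKernel u] (o : Kernel 𝒵 𝒳) [IsMarkovKernel o]
    (s : ℝ≥0 → Kernel 𝒵 𝒳) [∀ t, IsMarkovKernel (s t)]
    (Z : Fin (m + 2) → Ω → 𝒵) (X : Fin (m + 2) → Ω → 𝒳) (Y : ℝ≥0 → Fin (m + 2) → Ω → 𝒳)
    (hX : IsHMM P Z X u o) (hY : ∀ t, IsHMM P Z (Y t) u (s t))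
    (U : G →L[ℝ] G) (hU : WellSpecifiedCME u U)
    (O : G →L[ℝ] H) (hO : WellSpecifiedCME o O)
    (S : ℝ≥0 → G →L[ℝ] H) (hS : ∀ t, WellSpecifiedCME (s t) (S t))
    {ι : Type*} (L : SummationFilter ι) [L.NeBot] [L.LeAtTop]
    (lam : ι → ℝ) (h g : ι → G)
    (hdecomp : ∀ f : G, HasSum (fun i => (lam i * ⟪g i, f⟫_ℝ) • h i) (U f) L)
    (b : ι → G) (hb : ∀ i, b i = comul hGmul (∫ ω, feature G (Z 0 ω) ∂P) (g i))
    (w : ι → ι → G) (hw : ∀ i j, w i j = comul hGmul (h i) (g j))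
    (x : Fin (m + 2) → 𝒳) :
    Integrable (fun ω => feature G (Z 0 ω)) P ∧
    Integrable (fun ω => elemTensor fun k => feature G (Z k ω)) P ∧
    (Integrable (fun ω => elemTensor fun k => feature H (X k ω)) P ∧
      ⟪elemTensor fun k => feature H (x k), seqMeanEmbedding H P X⟫_ℝ =
        ⟪elemTensor fun k => feature H (x k), powMap O (m + 1) (seqMeanEmbedding G P Z)⟫_ℝ ∧
      (∀ σ : Equiv.Perm (Fin (m + 1)),
        HasIterSum L (m + 1) (fun v => contractionTerm O b w h lam x (v ∘ σ))
          ⟪elemTensor fun k => feature H (x k), seqMeanEmbedding H P X⟫_ℝ) ∧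
      (Orthonormal ℝ h → Orthonormal ℝ g → Summable (fun i => lam i ^ 2) →
        HasSum (contractionTerm O b w h lam x)
          ⟪elemTensor fun k => feature H (x k), seqMeanEmbedding H P X⟫_ℝ)) ∧
    (∀ t : ℝ≥0,
      Integrable (fun ω => elemTensor fun k => feature H (Y t k ω)) P ∧
      ⟪elemTensor fun k => feature H (x k), seqMeanEmbedding H P (Y t)⟫_ℝ =
        ⟪elemTensor fun k => feature H (x k), powMap (S t) (m + 1) (seqMeanEmbedding G P Z)⟫_ℝ ∧
      (∀ σ : Equiv.Perm (Fin (m + 1)),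
        HasIterSum L (m + 1) (fun v => contractionTerm (S t) b w h lam x (v ∘ σ))
          ⟪elemTensor fun k => feature H (x k), seqMeanEmbedding H P (Y t)⟫_ℝ) ∧
      (Orthonormal ℝ h → Orthonormal ℝ g → Summable (fun i => lam i ^ 2) →
        HasSum (contractionTerm (S t) b w h lam x)
          ⟪elemTensor fun k => feature H (x k), seqMeanEmbedding H P (Y t)⟫_ℝ)) := by
  refine ⟨(hG.integrable_feature (P.map (Z 0))).comp_measurable (hX.measurable_hidden 0),
    hG.integrable_elemTensor P hX.measurable_hidden,
    hX.meanEmbedding_contraction hH hG hGmul hU hO L lam h g hdecomp b hb w hw x, fun t =>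
    (hY t).meanEmbedding_contraction hH hG hGmul hU (hS t) L lam h g hdecomp b hb w hw x⟩
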